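/- Assume the Continuum Hypothesis, $\mathfrak{c}=\aleph_1$. Let $X$ be a linearly ordered set equipped with its order topology, and suppose that $X$ is connected, has a first element and no last element, has countable cofinality (that is, the least cardinality of a cofinal subset of $X$ is $\aleph_0$), and has weight at most $\mathfrak{c}=2^{\aleph_0}$ (that is, $X$ has a base for its topology of cardinality at most $\mathfrak{c}$). Then the Čech–Stone remainder $X^*=\beta X\setminus X$ is homeomorphic to $\mathbb{H}^*=\beta\mathbb{H}\setminus\mathbb{H}$, the Čech–Stone remainder of the half line $\mathbb{H}=[0,\infty)$ with its usual topology. -/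

import Mathlib

open Cardinal

/-- The weight of a topological space: the least cardinality of a base for its open sets. -/
noncomputable def topWeight (X : Type*) [TopologicalSpace X] : Cardinal :=
  sInf {κ | ∃ B : Set (Set X), TopologicalSpace.IsTopologicalBasis B ∧ #B = κ}

/-- The least cardinality in the definition of the weight is attained by some base. -/
theorem exists_isTopologicalBasis_mk_eq_topWeight (X : Type*) [TopologicalSpace X] :
    ∃ B : Set (Set X), TopologicalSpace.IsTopologicalBasis B ∧ #B = topWeight X :=
  csInf_mem (s := {κ | ∃ B : Set (Set X), TopologicalSpace.IsTopologicalBasis B ∧ #B = κ})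
    ⟨_, _, TopologicalSpace.isTopologicalBasis_opens, rfl⟩

/-- The Čech–Stone remainder `X* = βX ∖ X`, with the subspace topology from `βX`. -/
abbrev StoneCechRemainder (X : Type*) [TopologicalSpace X] : Type _ :=
  {p : StoneCech X // p ∉ Set.range (stoneCechUnit : X → StoneCech X)}

/-!
Write `X` as the union of an initial segment and of compact intervals `[xₙ, xₙ₊₁]`, where `(xₙ)` is
strictly increasing and cofinal, and fix a dense set `D ⊆ X` of cardinality at most `𝔠` that
contains the first element and all `xₙ` (an `OrderFrame`). A *code* prescribes, for each `n`, a
finite set of intervals with endpoints in `D`; it describes the closed set that on `[xₙ, xₙ₊₁]` is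
the union of these intervals. By compactness of the intervals, the traces on `X*` of the closures
of these sets separate disjoint closed sets (`separatesClosed_remainderTrace`), so that `X*` is
determined by the pattern of which finite families of traces have nonempty intersection
(`nonempty_homeomorph_of_finite_inter`). In a normal space closure in `βX` commutes with finite
intersections of closed sets, so that such an intersection is nonempty if and only if the
corresponding intersection in `X` is unbounded. The pattern is thus decided by the behaviour of the
codes at almost all `n`, and only depends on the order types of the finitely many endpoints
involved.

Let `Y` be the half line with a frame of its own. A relation between codes for `X` and codes for
`Y` is *coherent* if for every finite part of it and almost every `n` a single finite partial order
isomorphism carries all the first codes at stage `n` to the second ones. Coherence preserves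
the pattern above (`Coherent.biInter_remainderTrace_nonempty`), since a partial isomorphism extends
to any further point. Countable coherent relations extend to any further code on either side
(`Coherent.exists_insert`): a diagonal argument builds the new code stage by stage, which is the
countable saturation of reduced products modulo the cofinite filter. There are at most `𝔠` codes,
so that under CH a back-and-forth construction of length `ω₁` has only countable stages and yields
a coherent relation in which every code of either side occurs (`exists_coherent_total`).
-/

open Set Filter Topology

/-! ### Finite partial isomorphisms of linear orders -/

section PartialIso

variable {X Y : Type*} [LinearOrder X] [LinearOrder Y]

/-- A finite set of pairs that is the graph of an order isomorphism between finite subsets of `X`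
and `Y`. -/
def IsPartialIso (σ : Finset (X × Y)) : Prop :=
  ∀ p ∈ σ, ∀ q ∈ σ, (p.1 < q.1 ↔ p.2 < q.2)

theorem IsPartialIso.le_iff {σ : Finset (X × Y)} (h : IsPartialIso σ) {p q : X × Y}
    (hp : p ∈ σ) (hq : q ∈ σ) : p.1 ≤ q.1 ↔ p.2 ≤ q.2 := by
  rw [← not_lt, ← not_lt, h q hq p hp]

theorem IsPartialIso.eq_iff {σ : Finset (X × Y)} (h : IsPartialIso σ) {p q : X × Y}
    (hp : p ∈ σ) (hq : q ∈ σ) : p.1 = q.1 ↔ p.2 = q.2 := by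
  rw [le_antisymm_iff, le_antisymm_iff, h.le_iff hp hq, h.le_iff hq hp]

theorem IsPartialIso.swap {σ : Finset (X × Y)} (h : IsPartialIso σ) :
    IsPartialIso (σ.image Prod.swap) := by
  intro p hp q hq
  simp only [Finset.mem_image] at hp hq
  obtain ⟨p, hp, rfl⟩ := hp
  obtain ⟨q, hq, rfl⟩ := hq
  exact (h p hp q hq).symm

/-- The extension step of Cantor's back-and-forth argument, with the new value taken in a dense
subset `E`. -/
theorem IsPartialIso.exists_insert [OrderBot X] [OrderBot Y] [NoMaxOrder Y] {E : Set Y}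
    (hE : ∀ a b : Y, a < b → ∃ e ∈ E, a < e ∧ e < b) {σ : Finset (X × Y)} (h : IsPartialIso σ)
    (hbot : (⊥, ⊥) ∈ σ) (hσE : ∀ p ∈ σ, p.2 ∈ E) (x : X) :
    ∃ y ∈ E, IsPartialIso (insert (x, y) σ) := by
  by_cases hx : ∃ p ∈ σ, p.1 = x
  · obtain ⟨p, hp, rfl⟩ := hx
    refine ⟨p.2, hσE p hp, ?_⟩
    rwa [Prod.mk.eta, Finset.insert_eq_of_mem hp]
  push Not at hx
  have hxbot : ⊥ < x := bot_lt_iff_ne_bot.2 (hx _ hbot).symm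
  let L := (σ.filter (fun p => p.1 < x)).image Prod.snd
  let U := (σ.filter (fun p => x < p.1)).image Prod.snd
  have hL : L.Nonempty :=
    ⟨⊥, Finset.mem_image.2 ⟨(⊥, ⊥), Finset.mem_filter.2 ⟨hbot, hxbot⟩, rfl⟩⟩
  obtain ⟨u, hu, hU⟩ : ∃ u, L.max' hL < u ∧ ∀ v ∈ U, u ≤ v := by
    by_cases hUn : U.Nonempty
    · refine ⟨U.min' hUn, ?_, fun v hv => U.min'_le v hv⟩
      have h1 := L.max'_mem hL
      have h2 := U.min'_mem hUn
      simp only [L, U, Finset.mem_image, Finset.mem_filter] at h1 h2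
      obtain ⟨p, ⟨hp, hpx⟩, hp'⟩ := h1
      obtain ⟨q, ⟨hq, hqx⟩, hq'⟩ := h2
      rw [← hp', ← hq']
      exact (h p hp q hq).1 (hpx.trans hqx)
    · obtain ⟨u, hu⟩ := exists_gt (L.max' hL)
      exact ⟨u, hu, fun v hv => (hUn ⟨v, hv⟩).elim⟩
  obtain ⟨y, hyE, hy1, hy2⟩ := hE _ _ hu
  have key : ∀ p ∈ σ, (p.1 < x ∧ p.2 < y) ∨ (x < p.1 ∧ y < p.2) := by
    intro p hp
    rcases lt_or_gt_of_ne (hx p hp) with hlt | hgt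
    · refine Or.inl ⟨hlt, lt_of_le_of_lt (L.le_max' _ ?_) hy1⟩
      exact Finset.mem_image.2 ⟨p, Finset.mem_filter.2 ⟨hp, hlt⟩, rfl⟩
    · refine Or.inr ⟨hgt, lt_of_lt_of_le hy2 (hU _ ?_)⟩
      exact Finset.mem_image.2 ⟨p, Finset.mem_filter.2 ⟨hp, hgt⟩, rfl⟩
  refine ⟨y, hyE, ?_⟩
  intro p hp q hq
  rcases Finset.mem_insert.1 hp with rfl | hp <;> rcases Finset.mem_insert.1 hq with rfl | hq
  · simp
  · rcases key q hq with ⟨h1, h2⟩ | ⟨h1, h2⟩ <;> simp [h1, h2, h1.not_gt, h2.not_gt]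
  · rcases key p hp with ⟨h1, h2⟩ | ⟨h1, h2⟩ <;> simp [h1, h2, h1.not_gt, h2.not_gt]
  · exact h p hp q hq

end PartialIso

/-! ### Frames and codes for closed sets -/

/-- The skeleton of a linear order used to describe closed sets: an order-dense set `D` containing
the first element, and a strictly increasing cofinal sequence of points of `D`. -/
structure OrderFrame (X : Type*) [LinearOrder X] [OrderBot X] where
  /-- The dense set of admissible endpoints. -/
  D : Set X
  /-- The cofinal sequence cutting the order into consecutive closed intervals. -/
  pt : ℕ → X
  bot_mem : ⊥ ∈ D
  pt_mem : ∀ n, pt n ∈ D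
  exists_mem_Ioo : ∀ a b : X, a < b → ∃ d ∈ D, a < d ∧ d < b
  strictMono : StrictMono pt
  bot_lt : ⊥ < pt 0
  cofinal : ∀ a, ∃ n, a < pt n

namespace OrderFrame

section Codes

variable {X : Type*} [LinearOrder X] [OrderBot X] (F : OrderFrame X)

/-- A code prescribes, for each `n`, a finite set of intervals with endpoints in `D`, given by
their pairs of endpoints. -/
abbrev Code : Type _ := ℕ → Finset (F.D × F.D)

/-- The union of the finitely many intervals that the code prescribes at stage `n`. -/
def cover (c : F.Code) (n : ℕ) : Set X := ⋃ p ∈ c n, Icc (p.1 : X) p.2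

/-- The subset of `X` described by a code: on the `n`-th interval `[pt n, pt (n + 1)]` it is the
finite union of intervals prescribed at stage `n`. -/
def realize (c : F.Code) : Set X := ⋃ n, Icc (F.pt n) (F.pt (n + 1)) ∩ F.cover c n

theorem mem_cover {c : F.Code} {n : ℕ} {x : X} :
    x ∈ F.cover c n ↔ ∃ p ∈ c n, (p.1 : X) ≤ x ∧ x ≤ p.2 := by
  simp only [cover, mem_iUnion, mem_Icc, exists_prop]

/-- Besides stage `n + 1`, only stage `n` can contribute points of `[pt (n + 1), pt (n + 2))`
to the set of a code, and then only the common endpoint of the two intervals. -/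
theorem mem_realize_iff {c : F.Code} {n : ℕ} {x : X}
    (hx : x ∈ Ico (F.pt (n + 1)) (F.pt (n + 2))) :
    x ∈ F.realize c ↔ x ∈ F.cover c (n + 1) ∨ (x = F.pt (n + 1) ∧ x ∈ F.cover c n) := by
  simp only [realize, mem_iUnion, mem_inter_iff]
  constructor
  · rintro ⟨m, ⟨h1, h2⟩, h3⟩
    have hm1 : m < n + 2 := F.strictMono.lt_iff_lt.1 (h1.trans_lt hx.2)
    have hm2 : n + 1 ≤ m + 1 := F.strictMono.le_iff_le.1 (hx.1.trans h2)
    obtain rfl | rfl : m = n + 1 ∨ m = n := by omega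
    · exact Or.inl h3
    · exact Or.inr ⟨le_antisymm h2 hx.1, h3⟩
  · rintro (h | ⟨h1, h2⟩)
    · exact ⟨n + 1, ⟨hx.1, hx.2.le⟩, h⟩
    · exact ⟨n, ⟨h1 ▸ (F.strictMono n.lt_succ_self).le, h1.le⟩, h2⟩

theorem exists_mem_Ico {N : ℕ} {x : X} (hx : F.pt N ≤ x) :
    ∃ n, N ≤ n ∧ x ∈ Ico (F.pt n) (F.pt (n + 1)) := by
  classical
  have hex := F.cofinal x
  have h0 : Nat.find hex ≠ 0 := by
    intro h0
    have := Nat.find_spec hex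
    rw [h0] at this
    exact absurd ((F.strictMono.monotone N.zero_le).trans hx) (not_le.2 this)
  obtain ⟨n, hn⟩ := Nat.exists_eq_succ_of_ne_zero h0
  have h1 : x < F.pt (n + 1) := by
    have := Nat.find_spec hex
    rwa [hn] at this
  have h2 : F.pt n ≤ x := not_lt.1 (Nat.find_min hex (by omega))
  refine ⟨n, ?_, h2, h1⟩
  have := F.strictMono.lt_iff_lt.1 (hx.trans_lt h1)
  omega

end Codes

/-! ### Coherent relations between codes -/

section Coherence

variable {X Y : Type*} [LinearOrder X] [OrderBot X] [LinearOrder Y] [OrderBot Y]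
  (F : OrderFrame X) (G : OrderFrame Y)

/-- A finite partial isomorphism between the dense sets of two frames that respects the first
elements and the `n`-th intervals. -/
structure Admissible (n : ℕ) (σ : Finset (X × Y)) : Prop where
  isPartialIso : IsPartialIso σ
  fst_mem : ∀ p ∈ σ, p.1 ∈ F.D
  snd_mem : ∀ p ∈ σ, p.2 ∈ G.D
  bot_mem : (⊥, ⊥) ∈ σ
  left_mem : (F.pt n, G.pt n) ∈ σ
  right_mem : (F.pt (n + 1), G.pt (n + 1)) ∈ σ

/-- The partial map `σ` carries the set `c` of pairs of endpoints onto the set `d`. -/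
def Carries (σ : Finset (X × Y)) (c : Finset (F.D × F.D)) (d : Finset (G.D × G.D)) : Prop :=
  (∀ p ∈ c, ∃ q ∈ d, ((p.1 : X), (q.1 : Y)) ∈ σ ∧ ((p.2 : X), (q.2 : Y)) ∈ σ) ∧
  ∀ q ∈ d, ∃ p ∈ c, ((p.1 : X), (q.1 : Y)) ∈ σ ∧ ((p.2 : X), (q.2 : Y)) ∈ σ

/-- At stage `n` all pairs of codes in `T` look alike: a single finite partial isomorphism carries
the first code of each pair to the second one. -/
def MatchedAt (T : Set (F.Code × G.Code)) (n : ℕ) : Prop :=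
  ∃ σ, Admissible F G n σ ∧ ∀ t ∈ T, Carries F G σ (t.1 n) (t.2 n)

/-- A relation between codes all of whose finite parts are matched at almost all stages. -/
def Coherent (S : Set (F.Code × G.Code)) : Prop :=
  ∀ T ⊆ S, T.Finite → ∀ᶠ n in atTop, MatchedAt F G T n

variable {F G}

theorem Admissible.swap {n : ℕ} {σ : Finset (X × Y)} (h : Admissible F G n σ) :
    Admissible G F n (σ.image Prod.swap) where
  isPartialIso := h.isPartialIso.swap
  fst_mem := by
    intro p hp
    obtain ⟨q, hq, rfl⟩ := Finset.mem_image.1 hp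
    exact h.snd_mem q hq
  snd_mem := by
    intro p hp
    obtain ⟨q, hq, rfl⟩ := Finset.mem_image.1 hp
    exact h.fst_mem q hq
  bot_mem := Finset.mem_image.2 ⟨_, h.bot_mem, rfl⟩
  left_mem := Finset.mem_image.2 ⟨_, h.left_mem, rfl⟩
  right_mem := Finset.mem_image.2 ⟨_, h.right_mem, rfl⟩

theorem Carries.swap {σ : Finset (X × Y)} {c : Finset (F.D × F.D)} {d : Finset (G.D × G.D)}
    (h : Carries F G σ c d) : Carries G F (σ.image Prod.swap) d c := by
  refine ⟨fun q hq => ?_, fun p hp => ?_⟩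
  · obtain ⟨p, hp, h1, h2⟩ := h.2 q hq
    exact ⟨p, hp, Finset.mem_image.2 ⟨_, h1, rfl⟩, Finset.mem_image.2 ⟨_, h2, rfl⟩⟩
  · obtain ⟨q, hq, h1, h2⟩ := h.1 p hp
    exact ⟨q, hq, Finset.mem_image.2 ⟨_, h1, rfl⟩, Finset.mem_image.2 ⟨_, h2, rfl⟩⟩

theorem Carries.mono {σ τ : Finset (X × Y)} {c : Finset (F.D × F.D)} {d : Finset (G.D × G.D)}
    (h : Carries F G σ c d) (hs : σ ⊆ τ) : Carries F G τ c d := by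
  refine ⟨fun p hp => ?_, fun q hq => ?_⟩
  · obtain ⟨q, hq, h1, h2⟩ := h.1 p hp
    exact ⟨q, hq, hs h1, hs h2⟩
  · obtain ⟨p, hp, h1, h2⟩ := h.2 q hq
    exact ⟨p, hp, hs h1, hs h2⟩

theorem MatchedAt.swap {T : Set (F.Code × G.Code)} {n : ℕ} (h : MatchedAt F G T n) :
    MatchedAt G F (Prod.swap '' T) n := by
  obtain ⟨σ, hσ, hT⟩ := h
  refine ⟨_, hσ.swap, ?_⟩
  rintro _ ⟨t, ht, rfl⟩
  exact (hT t ht).swap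

theorem MatchedAt.mono {T T' : Set (F.Code × G.Code)} {n : ℕ} (h : MatchedAt F G T' n)
    (hT : T ⊆ T') : MatchedAt F G T n := by
  obtain ⟨σ, hσ, hT'⟩ := h
  exact ⟨σ, hσ, fun t ht => hT' t (hT ht)⟩

theorem Coherent.swap {S : Set (F.Code × G.Code)} (h : Coherent F G S) :
    Coherent G F (Prod.swap '' S) := by
  intro T hT hfin
  have hT' : Prod.swap '' T ⊆ S := by
    rintro _ ⟨t, ht, rfl⟩
    obtain ⟨s, hs, rfl⟩ := hT ht
    simpa using hs
  filter_upwards [h _ hT' (hfin.image _)] with n hn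
  have := hn.swap
  rwa [← image_comp, Prod.swap_swap_eq, image_id] at this

theorem matchedAt_empty (F : OrderFrame X) (G : OrderFrame Y) (n : ℕ) : MatchedAt F G ∅ n := by
  classical
  refine ⟨{(⊥, ⊥), (F.pt n, G.pt n), (F.pt (n + 1), G.pt (n + 1))}, ⟨?_, ?_, ?_, ?_, ?_, ?_⟩, ?_⟩
  · have h1 : ∀ n, ⊥ < F.pt n := fun n => F.bot_lt.trans_le (F.strictMono.monotone n.zero_le)
    have h2 : ∀ n, ⊥ < G.pt n := fun n => G.bot_lt.trans_le (G.strictMono.monotone n.zero_le)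
    have h3 := F.strictMono n.lt_succ_self
    have h4 := G.strictMono n.lt_succ_self
    intro p hp q hq
    simp only [Finset.mem_insert, Finset.mem_singleton] at hp hq
    rcases hp with rfl | rfl | rfl <;> rcases hq with rfl | rfl | rfl <;>
      simp [h1, h2, h3, h4, h3.not_gt, h4.not_gt]
  · simp [F.bot_mem, F.pt_mem]
  · simp [G.bot_mem, G.pt_mem]
  all_goals simp

/-- A property that holds eventually at each level `k`, and is weaker at lower levels, holds at
stage `n` at a level tending to infinity with `n`. -/
theorem exists_tendsto_of_eventually {Q : ℕ → ℕ → Prop} (h0 : ∀ n, Q 0 n)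
    (h : ∀ k, ∀ᶠ n in atTop, Q k n) :
    ∃ K : ℕ → ℕ, (∀ k, ∀ᶠ n in atTop, k ≤ K n) ∧ ∀ n, Q (K n) n := by
  classical
  refine ⟨fun n => Nat.findGreatest (fun k => Q k n) n, fun k => ?_, fun n => ?_⟩
  · filter_upwards [h k, eventually_ge_atTop k] with n hn hk
    exact Nat.le_findGreatest hk hn
  · exact Nat.findGreatest_spec (P := fun k => Q k n) n.zero_le (h0 n)

theorem Coherent.of_finite {S : Set (F.Code × G.Code)}
    (h : ∀ T ⊆ S, T.Finite → Coherent F G T) : Coherent F G S :=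
  fun T hT hfin => h T hT hfin T Subset.rfl hfin

theorem Coherent.mono {S S' : Set (F.Code × G.Code)} (h : Coherent F G S') (hS : S ⊆ S') :
    Coherent F G S := fun T hT => h T (hT.trans hS)

/-- A partial isomorphism extended by `(x, y)` transports membership of `x` in a finite union of
intervals to membership of `y` in the image union. -/
theorem Carries.mem_cover_iff {σ : Finset (X × Y)} {x : X} {y : Y}
    (h : IsPartialIso (insert (x, y) σ)) {c : F.Code} {d : G.Code} {n : ℕ}
    (hc : Carries F G σ (c n) (d n)) : x ∈ F.cover c n ↔ y ∈ G.cover d n := by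
  have h0 := Finset.mem_insert_self (x, y) σ
  rw [mem_cover, mem_cover]
  constructor
  · rintro ⟨p, hp, h1, h2⟩
    obtain ⟨q, hq, hq1, hq2⟩ := hc.1 p hp
    exact ⟨q, hq, (h.le_iff (Finset.mem_insert_of_mem hq1) h0).1 h1,
      (h.le_iff h0 (Finset.mem_insert_of_mem hq2)).1 h2⟩
  · rintro ⟨q, hq, h1, h2⟩
    obtain ⟨p, hp, hp1, hp2⟩ := hc.2 q hq
    exact ⟨p, hp, (h.le_iff (Finset.mem_insert_of_mem hp1) h0).2 h1,
      (h.le_iff h0 (Finset.mem_insert_of_mem hp2)).2 h2⟩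

variable [NoMaxOrder Y]

theorem Admissible.exists_insert {n : ℕ} {σ : Finset (X × Y)} (h : Admissible F G n σ) (x : X) :
    ∃ y, IsPartialIso (insert (x, y) σ) ∧ (x ∈ F.D → Admissible F G n (insert (x, y) σ)) := by
  obtain ⟨y, hy, hi⟩ :=
    h.isPartialIso.exists_insert G.exists_mem_Ioo h.bot_mem h.snd_mem x
  refine ⟨y, hi, fun hx => ⟨hi, ?_, ?_, Finset.mem_insert_of_mem h.bot_mem,
    Finset.mem_insert_of_mem h.left_mem, Finset.mem_insert_of_mem h.right_mem⟩⟩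
  · intro p hp
    rcases Finset.mem_insert.1 hp with rfl | hp
    exacts [hx, h.fst_mem p hp]
  · intro p hp
    rcases Finset.mem_insert.1 hp with rfl | hp
    exacts [hy, h.snd_mem p hp]

theorem Admissible.exists_superset_dom {n : ℕ} {σ : Finset (X × Y)} (h : Admissible F G n σ)
    (A : Finset X) (hA : ∀ a ∈ A, a ∈ F.D) :
    ∃ τ, σ ⊆ τ ∧ Admissible F G n τ ∧ ∀ a ∈ A, ∃ b, (a, b) ∈ τ := by
  classical
  induction A using Finset.induction_on with
  | empty => exact ⟨σ, Finset.Subset.refl _, h, by simp⟩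
  | insert a A _ ih =>
    obtain ⟨τ, hστ, hτ, hdom⟩ := ih fun b hb => hA b (Finset.mem_insert_of_mem hb)
    obtain ⟨y, -, hy⟩ := hτ.exists_insert a
    refine ⟨_, hστ.trans (Finset.subset_insert _ _), hy (hA a (Finset.mem_insert_self _ _)), ?_⟩
    intro b hb
    rcases Finset.mem_insert.1 hb with rfl | hb
    · exact ⟨y, Finset.mem_insert_self _ _⟩
    · obtain ⟨b', hb'⟩ := hdom b hb
      exact ⟨b', Finset.mem_insert_of_mem hb'⟩

theorem Admissible.exists_carries {n : ℕ} {σ : Finset (X × Y)} (h : Admissible F G n σ)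
    (c : Finset (F.D × F.D)) :
    ∃ τ d, σ ⊆ τ ∧ Admissible F G n τ ∧ Carries F G τ c d := by
  classical
  obtain ⟨τ, hστ, hτ, hdom⟩ := h.exists_superset_dom
    (c.image (fun p => (p.1 : X)) ∪ c.image (fun p => (p.2 : X))) (by
      intro a ha
      simp only [Finset.mem_union, Finset.mem_image] at ha
      rcases ha with ⟨p, -, rfl⟩ | ⟨p, -, rfl⟩
      exacts [p.1.2, p.2.2])
  choose! f hf using hdom
  have h1 : ∀ p ∈ c, ((p.1 : X), f p.1) ∈ τ := fun p hp => hf _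
    (Finset.mem_union_left _ (Finset.mem_image_of_mem (fun p : F.D × F.D => (p.1 : X)) hp))
  have h2 : ∀ p ∈ c, ((p.2 : X), f p.2) ∈ τ := fun p hp => hf _
    (Finset.mem_union_right _ (Finset.mem_image_of_mem (fun p : F.D × F.D => (p.2 : X)) hp))
  refine ⟨τ, c.attach.image (fun p => (⟨f p.1.1, hτ.snd_mem _ (h1 p.1 p.2)⟩,
    ⟨f p.1.2, hτ.snd_mem _ (h2 p.1 p.2)⟩)), hστ, hτ, fun p hp => ?_, fun q hq => ?_⟩
  · exact ⟨_, Finset.mem_image_of_mem _ (Finset.mem_attach _ ⟨p, hp⟩), h1 p hp, h2 p hp⟩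
  · obtain ⟨p, -, rfl⟩ := Finset.mem_image.1 hq
    exact ⟨p, p.2, h1 p p.2, h2 p p.2⟩

/-- Countable coherent relations extend to any further code. The image of the code is built stage
by stage, using at stage `n` a partial isomorphism that works for a number of pairs tending to
infinity with `n`; this is the countable saturation of reduced products. -/
theorem Coherent.exists_insert {S : Set (F.Code × G.Code)} (h : Coherent F G S)
    (hS : S.Countable) (c : F.Code) : ∃ d, Coherent F G (insert (c, d) S) := by
  obtain ⟨f, hf⟩ := countable_iff_exists_injOn.1 hS
  -- The finite sets `A k` increase to `S`.
  let A : ℕ → Set (F.Code × G.Code) := fun k => {s | s ∈ S ∧ f s < k}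
  have hA : ∀ k, (A k).Finite := fun k =>
    Set.Finite.of_finite_image ((finite_Iio k).subset (by rintro _ ⟨s, hs, rfl⟩; exact hs.2))
      (hf.mono fun s hs => hs.1)
  obtain ⟨K, hK, hKQ⟩ := exists_tendsto_of_eventually (Q := fun k n => MatchedAt F G (A k) n)
    (fun n => (matchedAt_empty F G n).mono fun s hs => absurd hs.2 (Nat.not_lt_zero _))
    (fun k => h _ (fun s hs => hs.1) (hA k))
  choose σ hσ hσA using hKQ
  choose τ d hστ hτ hd using fun n => (hσ n).exists_carries (c n)
  refine ⟨d, fun T hT hfin => ?_⟩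
  obtain ⟨k, hk⟩ : ∃ k, ∀ t ∈ T, f t < k := by
    obtain ⟨k, hk⟩ := (hfin.image f).bddAbove
    exact ⟨k + 1, fun t ht => Nat.lt_succ_of_le (hk (mem_image_of_mem f ht))⟩
  filter_upwards [hK k] with n hn
  refine ⟨τ n, hτ n, fun t ht => ?_⟩
  rcases hT ht with rfl | htS
  · exact hd n
  · exact (hσA n t ⟨htS, (hk t ht).trans_le hn⟩).mono (hστ n)

/-- Points far out in `X` have counterparts in `Y` lying in the corresponding interval and in the
same sets among those described by finitely many coherent pairs of codes. -/
theorem Coherent.exists_counterpart {S : Set (F.Code × G.Code)} (h : Coherent F G S)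
    {T : Set (F.Code × G.Code)} (hT : T ⊆ S) (hfin : T.Finite) :
    ∃ N, ∀ n ≥ N, ∀ x ∈ Ico (F.pt n) (F.pt (n + 1)), ∃ y ∈ Ico (G.pt n) (G.pt (n + 1)),
      ∀ t ∈ T, x ∈ F.realize t.1 ↔ y ∈ G.realize t.2 := by
  obtain ⟨N, hN⟩ := eventually_atTop.1 (h T hT hfin)
  refine ⟨N + 1, fun n hn x hx => ?_⟩
  obtain ⟨n, rfl⟩ : ∃ m, n = m + 1 := ⟨n - 1, by omega⟩
  obtain ⟨σ, hσ, hσT⟩ := hN n (by omega)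
  obtain ⟨τ, hτ, hτT⟩ := hN (n + 1) (by omega)
  obtain ⟨y, hi, -⟩ := hτ.exists_insert x
  have h0 := Finset.mem_insert_self (x, y) τ
  have hl := Finset.mem_insert_of_mem (b := (x, y)) hτ.left_mem
  have hr := Finset.mem_insert_of_mem (b := (x, y)) hτ.right_mem
  have hy : y ∈ Ico (G.pt (n + 1)) (G.pt (n + 2)) :=
    ⟨(hi.le_iff hl h0).1 hx.1, (hi _ h0 _ hr).1 hx.2⟩
  have hσ' : IsPartialIso (insert (F.pt (n + 1), G.pt (n + 1)) σ) := by
    rw [Finset.insert_eq_of_mem hσ.right_mem]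
    exact hσ.isPartialIso
  refine ⟨y, hy, fun t ht => ?_⟩
  have h1 : x = F.pt (n + 1) ↔ y = G.pt (n + 1) := hi.eq_iff h0 hl
  have h2 := (hσT t ht).mem_cover_iff hσ'
  rw [F.mem_realize_iff hx, G.mem_realize_iff hy, (hτT t ht).mem_cover_iff hi, h1]
  refine or_congr Iff.rfl (and_congr_right fun hy' => ?_)
  rw [hy', h1.2 hy', h2]

end Coherence

end OrderFrame

/-! ### Transfinite back-and-forth -/

/-- Transfinite recursion for a property of finite character: if every countable good set can be
enlarged by a solution of any given task, then along a well-order with countable initial segments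
all tasks can be solved inside one good set. -/
theorem exists_good_set_solving_tasks {α τ I : Type*} [LinearOrder I] [WellFoundedLT I]
    (hI : ∀ i : I, (Iio i).Countable) {Good : Set α → Prop} {R : τ → α → Prop}
    (hmono : ∀ S T, T ⊆ S → Good S → Good T)
    (hfin : ∀ S, (∀ T ⊆ S, T.Finite → Good T) → Good S) (hempty : Good ∅)
    (hext : ∀ S, Good S → S.Countable → ∀ t, ∃ p, R t p ∧ Good (insert p S)) (e : I → τ) :
    ∃ S, Good S ∧ ∀ i, ∃ p ∈ S, R (e i) p := by
  rcases isEmpty_or_nonempty I with hIe | ⟨⟨i₀⟩⟩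
  · exact ⟨∅, hempty, fun i => hIe.elim i⟩
  have : Nonempty α := ⟨(hext ∅ hempty countable_empty (e i₀)).choose⟩
  let step : (i : I) → ((j : I) → j < i → α) → α := fun i g =>
    Classical.epsilon fun p => R (e i) p ∧ Good (insert p {q | ∃ j, ∃ h : j < i, g j h = q})
  let f : I → α := (wellFounded_lt (α := I)).fix step
  have hf : ∀ i, f i = Classical.epsilon fun p => R (e i) p ∧ Good (insert p (f '' Iio i)) := by
    intro i
    have h1 : f i = step i fun j _ => f j := (wellFounded_lt (α := I)).fix_eq step i
    have h2 : {q | ∃ j, ∃ _ : j < i, f j = q} = f '' Iio i := by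
      ext q
      simp [mem_image]
    rw [h1, ← h2]
  have hunion : ∀ B : Set I, (∀ j ∈ B, Good (f '' Iic j)) → Good (f '' B) := by
    intro B hB
    refine hfin _ fun T hT hTfin => ?_
    obtain ⟨A, hAB, hA, rfl⟩ := exists_subset_image_finite_and.1 ⟨T, hT, hTfin, rfl⟩
    rcases A.eq_empty_or_nonempty with rfl | hne
    · simpa using hempty
    · obtain ⟨m, hm, hmax⟩ := hA.exists_maximalFor id A hne
      exact hmono _ _ (image_mono fun a ha => (le_total a m).elim id fun h => hmax ha h)
        (hB m (hAB hm))
  have hgood : ∀ i, Good (f '' Iic i) ∧ R (e i) (f i) := by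
    intro i
    induction i using WellFoundedLT.induction with
    | ind i ih =>
      have h1 : Good (f '' Iio i) := hunion _ fun j hj => (ih j hj).1
      have h2 := Classical.epsilon_spec (hext _ h1 ((hI i).image f) (e i))
      rw [← hf i, ← image_insert_eq, Iio_insert] at h2
      exact ⟨h2.2, h2.1⟩
  exact ⟨f '' univ, hunion _ fun j _ => (hgood j).1,
    fun i => ⟨f i, mem_image_of_mem f (mem_univ i), (hgood i).2⟩⟩

namespace OrderFrame

variable {X Y : Type*} [LinearOrder X] [OrderBot X] [NoMaxOrder X] [LinearOrder Y] [OrderBot Y]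
  [NoMaxOrder Y] {F : OrderFrame X} {G : OrderFrame Y}

/-- The back-and-forth construction of length `ω₁`. -/
theorem exists_coherent_total {I : Type*} [LinearOrder I] [WellFoundedLT I]
    (hI : ∀ i : I, (Iio i).Countable) (e : I → F.Code ⊕ G.Code) (he : Function.Surjective e) :
    ∃ S, Coherent F G S ∧ (∀ c, ∃ d, (c, d) ∈ S) ∧ ∀ d, ∃ c, (c, d) ∈ S := by
  obtain ⟨S, hS, hsol⟩ := exists_good_set_solving_tasks hI (Good := Coherent F G)
    (R := fun t p => Sum.elim (fun c => p.1 = c) (fun d => p.2 = d) t)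
    (fun S T hT hS => hS.mono hT) (fun S => Coherent.of_finite)
    (fun T hT _ => Eventually.of_forall fun n => (matchedAt_empty F G n).mono hT) (by
      rintro S hS hc (c | d)
      · obtain ⟨d, hd⟩ := hS.exists_insert hc c
        exact ⟨(c, d), rfl, hd⟩
      · obtain ⟨c, hc⟩ := hS.swap.exists_insert (hc.image _) d
        refine ⟨(c, d), rfl, ?_⟩
        have := hc.swap
        rwa [image_insert_eq, ← image_comp, Prod.swap_swap_eq, image_id] at this) e
  refine ⟨S, hS, fun c => ?_, fun d => ?_⟩
  · obtain ⟨i, hi⟩ := he (Sum.inl c)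
    obtain ⟨p, hp, hR⟩ := hsol i
    rw [hi] at hR
    subst hR
    exact ⟨p.2, hp⟩
  · obtain ⟨i, hi⟩ := he (Sum.inr d)
    obtain ⟨p, hp, hR⟩ := hsol i
    rw [hi] at hR
    subst hR
    exact ⟨p.1, hp⟩

end OrderFrame

/-! ### Compactness of intervals -/

/-- Closed intervals in a connected linearly ordered space are compact: an ultrafilter on `[a, b]`
without a limit would give the nontrivial clopen set of all `x` such that `Ioi x` is large. -/
theorem isCompact_Icc_of_connectedSpace {X : Type*} [LinearOrder X] [TopologicalSpace X]
    [OrderTopology X] [PreconnectedSpace X] (a b : X) : IsCompact (Icc a b) := by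
  rw [isCompact_iff_ultrafilter_le_nhds]
  intro f hf
  rw [le_principal_iff] at hf
  by_contra! hlim
  have hne : ∀ x ∈ Icc a b, {x} ∉ f := fun x hx hxf =>
    hlim x hx (le_trans (by simpa using hxf) (pure_le_nhds x))
  have hlim' : ∀ x ∈ Icc a b, (∃ l < x, Iic l ∈ f) ∨ ∃ u > x, Ici u ∈ f := by
    intro x hx
    by_contra! h
    refine hlim x hx ?_
    rw [nhds_eq_order]
    refine le_inf (le_iInf₂ fun l hl => ?_) (le_iInf₂ fun u hu => ?_)
    · rw [le_principal_iff]
      have := Ultrafilter.compl_mem_iff_notMem.2 (h.1 l hl)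
      rwa [compl_Iic] at this
    · rw [le_principal_iff]
      have := Ultrafilter.compl_mem_iff_notMem.2 (h.2 u hu)
      rwa [compl_Ici] at this
  have hempty : ∀ {s t : Set X}, s ∈ f → t ∈ f → Disjoint s t → False := fun hs ht hd =>
    f.empty_notMem (by simpa [hd.inter_eq] using inter_mem hs ht)
  -- Points outside `[a, b]` are harmless: `Ioi x` is large below `a` and small above `b`.
  have hopen : IsOpen {x | Ioi x ∈ f} := by
    rw [isOpen_iff_mem_nhds]
    intro x hx
    rcases lt_or_ge x a with hxa | hxa
    · filter_upwards [Iio_mem_nhds hxa] with z hz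
      exact mem_of_superset hf fun w hw => lt_of_lt_of_le hz hw.1
    have hxb : x ≤ b := by
      by_contra! hbx
      exact hempty hx hf (disjoint_left.2 fun w hw hw' => (hbx.trans hw).not_ge hw'.2)
    rcases hlim' x ⟨hxa, hxb⟩ with ⟨l, hl, hlf⟩ | ⟨u, hu, huf⟩
    · exact (hempty hx hlf (disjoint_left.2 fun w hw hw' => (hl.trans hw).not_ge hw')).elim
    · filter_upwards [Iio_mem_nhds hu] with z hz
      exact mem_of_superset huf fun w hw => lt_of_lt_of_le hz hw
  have hclosed : IsClosed {x | Ioi x ∈ f} := by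
    rw [← isOpen_compl_iff, isOpen_iff_mem_nhds]
    intro x hx
    have hx' : Iic x ∈ f := by
      have := Ultrafilter.compl_mem_iff_notMem.2 hx
      rwa [compl_Ioi] at this
    suffices h : ∃ l < x, Iic l ∈ f by
      obtain ⟨l, hl, hlf⟩ := h
      filter_upwards [Ioi_mem_nhds hl] with z hz hzf
      exact hempty hzf hlf (disjoint_left.2 fun w hw hw' => (lt_trans hz hw).not_ge hw')
    rcases lt_or_ge b x with hxb | hxb
    · exact ⟨b, hxb, mem_of_superset hf fun w hw => hw.2⟩
    have hxa : a ≤ x := by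
      by_contra! hax
      exact hempty hx' hf (disjoint_left.2 fun w hw hw' => (lt_of_le_of_lt hw hax).not_ge hw'.1)
    rcases hlim' x ⟨hxa, hxb⟩ with h | ⟨u, hu, huf⟩
    · exact h
    · exact (hempty hx' huf
        (disjoint_left.2 fun w hw hw' => (lt_of_lt_of_le hu hw').not_ge hw)).elim
  have hab : a ≤ b := by
    by_contra! h
    rw [Icc_eq_empty h.not_ge] at hf
    exact f.empty_notMem hf
  have ha : Ioi a ∈ f := by
    have := Ultrafilter.compl_mem_iff_notMem.2 (hne a ⟨le_rfl, hab⟩)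
    filter_upwards [hf, this] with w hw hw'
    exact lt_of_le_of_ne hw.1 (Ne.symm hw')
  have hb : Ioi b ∈ f := by
    have h := (isClopen_iff.1 ⟨hclosed, hopen⟩).resolve_left (fun h => by
      have : a ∈ {x | Ioi x ∈ f} := ha
      rw [h] at this
      exact this)
    have hbu : b ∈ {x | Ioi x ∈ f} := h ▸ mem_univ b
    exact hbu
  exact hempty hb hf (disjoint_left.2 fun w hw hw' => (lt_of_lt_of_le hw hw'.2).false)

/-! ### Closures in the Čech–Stone compactification -/

section StoneCech

variable {X : Type*} [TopologicalSpace X]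

/-- In a normal space, disjoint closed sets have disjoint closures in the Čech–Stone
compactification. -/
theorem disjoint_closure_image_stoneCechUnit [NormalSpace X] {A B : Set X} (hA : IsClosed A)
    (hB : IsClosed B) (h : Disjoint A B) :
    Disjoint (closure (stoneCechUnit '' A)) (closure (stoneCechUnit '' B)) := by
  obtain ⟨f, hf0, hf1, hf⟩ := exists_continuous_zero_one_of_isClosed hA hB h
  have hg : Continuous (fun x => (⟨f x, hf x⟩ : unitInterval)) := by fun_prop
  have hc := continuous_stoneCechExtend hg
  have h0 : closure (stoneCechUnit '' A) ⊆ stoneCechExtend hg ⁻¹' {0} := by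
    refine closure_minimal ?_ (isClosed_singleton.preimage hc)
    rintro _ ⟨x, hx, rfl⟩
    simpa using Subtype.ext (hf0 hx)
  have h1 : closure (stoneCechUnit '' B) ⊆ stoneCechExtend hg ⁻¹' {1} := by
    refine closure_minimal ?_ (isClosed_singleton.preimage hc)
    rintro _ ⟨x, hx, rfl⟩
    simpa using Subtype.ext (hf1 hx)
  refine disjoint_left.2 fun p hp hq => ?_
  have h2 : stoneCechExtend hg p = 0 := h0 hp
  have h3 : stoneCechExtend hg p = 1 := h1 hq
  rw [h2] at h3
  exact zero_ne_one h3

/-- In a normal space, closure in the Čech–Stone compactification commutes with intersections of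
closed sets: near a point outside the closure of `A ∩ B`, the sets `A` and `B` are disjoint. -/
theorem mem_closure_image_stoneCechUnit_inter [NormalSpace X] {A B : Set X} (hA : IsClosed A)
    (hB : IsClosed B) {p : StoneCech X} (hpA : p ∈ closure (stoneCechUnit '' A))
    (hpB : p ∈ closure (stoneCechUnit '' B)) : p ∈ closure (stoneCechUnit '' (A ∩ B)) := by
  by_contra hp
  obtain ⟨W, hW, hWc, hWs⟩ :=
    exists_mem_nhds_isClosed_subset (isClosed_closure.isOpen_compl.mem_nhds hp)
  have hloc : ∀ C : Set X, p ∈ closure (stoneCechUnit '' C) →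
      p ∈ closure (stoneCechUnit '' (C ∩ stoneCechUnit ⁻¹' W)) := by
    intro C hC
    rw [image_inter_preimage]
    rw [mem_closure_iff_frequently] at hC ⊢
    exact hC.and_eventually hW
  have hWX := hWc.preimage (continuous_stoneCechUnit (α := X))
  refine disjoint_left.1 (disjoint_closure_image_stoneCechUnit (hA.inter hWX) (hB.inter hWX) ?_)
    (hloc A hpA) (hloc B hpB)
  refine disjoint_left.2 fun x hx hx' => hWs hx.2 (subset_closure ?_)
  exact mem_image_of_mem _ ⟨hx.1, hx'.1⟩

theorem mem_closure_image_stoneCechUnit_biInter [NormalSpace X] {ι : Type*} {s : Set ι}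
    (hs : s.Finite) {A : ι → Set X} (hA : ∀ i, IsClosed (A i)) {p : StoneCech X}
    (hp : ∀ i ∈ s, p ∈ closure (stoneCechUnit '' A i)) :
    p ∈ closure (stoneCechUnit '' ⋂ i ∈ s, A i) := by
  induction s, hs using Set.Finite.induction_on with
  | empty => simpa using denseRange_stoneCechUnit (α := X) p
  | @insert i s _ hs ih =>
    rw [biInter_insert]
    exact mem_closure_image_stoneCechUnit_inter (hA i) (isClosed_biInter fun i _ => hA i)
      (hp i (mem_insert i s)) (ih fun j hj => hp j (mem_insert_of_mem i hj))

/-- The trace on the remainder of the closure in `βX` of a subset of `X`. -/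
def remainderTrace (Z : Set X) :
    Set (StoneCechRemainder X) :=
  {p | p.1 ∈ closure (stoneCechUnit '' Z)}

theorem isClosed_remainderTrace (Z : Set X) :
    IsClosed (remainderTrace Z) :=
  isClosed_closure.preimage continuous_subtype_val

end StoneCech

/-! ### Homeomorphisms from indexed families of closed sets -/

section IndexedHomeomorph

variable {K K' ι : Type*} [TopologicalSpace K] [TopologicalSpace K'] {A : ι → Set K}
  {A' : ι → Set K'}

/-- The family `A` of sets separates disjoint closed sets: some two members cover the space while
each of them misses one of the given closed sets. -/
def SeparatesClosed (A : ι → Set K) : Prop :=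
  ∀ P Q : Set K, IsClosed P → IsClosed Q → Disjoint P Q →
    ∃ i j, A i ∪ A j = Set.univ ∧ Disjoint (A i) P ∧ Disjoint (A j) Q

theorem SeparatesClosed.eq_of_mem_iff [T1Space K] (h : SeparatesClosed A) {x y : K}
    (hxy : ∀ i, x ∈ A i ↔ y ∈ A i) : x = y := by
  by_contra hne
  obtain ⟨i, j, hu, hi, hj⟩ := h {x} {y} isClosed_singleton isClosed_singleton (by simpa using hne)
  rw [disjoint_singleton_right] at hi hj
  have hx : x ∈ A i ∪ A j := hu ▸ mem_univ x
  exact hj ((hxy j).1 (hx.resolve_left hi))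

/-- A point of `K` has a counterpart in the compact space `K'`, lying in exactly the corresponding
members of the other family: compactness gives a point lying in at least those members, and
separation excludes all further ones. -/
theorem exists_forall_mem_iff [T1Space K] [CompactSpace K'] (hA : ∀ i, IsClosed (A i))
    (hA' : ∀ i, IsClosed (A' i))
    (hsep : SeparatesClosed A)
    (hinter : ∀ s : Set ι, s.Finite → ((⋂ i ∈ s, A i).Nonempty ↔ (⋂ i ∈ s, A' i).Nonempty))
    (x : K) : ∃ y, ∀ i, x ∈ A i ↔ y ∈ A' i := by
  obtain ⟨y, hy⟩ := CompactSpace.iInter_nonempty (t := fun i : {i // x ∈ A i} => A' i)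
    (fun i => hA' i) (fun s => by
      have := (hinter (Subtype.val '' (s : Set {i // x ∈ A i})) (s.finite_toSet.image _)).1
        ⟨x, by simp +contextual⟩
      simpa using this)
  rw [mem_iInter] at hy
  refine ⟨y, fun i => ⟨fun hi => hy ⟨i, hi⟩, fun hi => ?_⟩⟩
  by_contra hxi
  obtain ⟨j, k, hu, hj, hk⟩ := hsep {x} (A i) isClosed_singleton (hA i) (by simpa using hxi)
  rw [disjoint_singleton_right] at hj
  have hx : x ∈ A j ∪ A k := hu ▸ mem_univ x
  have hyk := hy ⟨k, hx.resolve_left hj⟩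
  obtain ⟨z, hz⟩ := (hinter {k, i} (by simp)).2 ⟨y, by simpa using ⟨hyk, hi⟩⟩
  rw [biInter_pair] at hz
  exact disjoint_left.1 hk hz.1 hz.2

theorem SeparatesClosed.continuous_of_mem_iff [T1Space K'] (hA : ∀ i, IsClosed (A i))
    (hsep : SeparatesClosed A') {φ : K → K'} (hφ : ∀ x i, x ∈ A i ↔ φ x ∈ A' i) :
    Continuous φ := by
  rw [continuous_iff_continuousAt]
  refine fun x U hU => mem_map.2 ?_
  obtain ⟨V, hVU, hV, hxV⟩ := mem_nhds_iff.1 hU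
  obtain ⟨i, j, hu, hi, hj⟩ := hsep {φ x} Vᶜ isClosed_singleton hV.isClosed_compl
    (by simpa using hxV)
  rw [disjoint_singleton_right] at hi
  filter_upwards [(hA i).isOpen_compl.mem_nhds (mt (hφ x i).1 hi)] with z hz
  have hz' : φ z ∈ A' i ∪ A' j := hu ▸ mem_univ _
  exact hVU (by_contra fun h =>
    disjoint_left.1 hj (hz'.resolve_left (mt (hφ z i).2 hz)) h)

/-- Two compact T₁ spaces are homeomorphic as soon as they carry separating families of
closed sets, with a common index set, in which the same finite subfamilies have nonempty
intersection. -/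
theorem nonempty_homeomorph_of_finite_inter [CompactSpace K] [T1Space K] [CompactSpace K']
    [T1Space K'] (hA : ∀ i, IsClosed (A i)) (hA' : ∀ i, IsClosed (A' i))
    (hsep : SeparatesClosed A) (hsep' : SeparatesClosed A')
    (hinter : ∀ s : Set ι, s.Finite → ((⋂ i ∈ s, A i).Nonempty ↔ (⋂ i ∈ s, A' i).Nonempty)) :
    Nonempty (K ≃ₜ K') := by
  choose φ hφ using exists_forall_mem_iff hA hA' hsep hinter
  choose ψ hψ using exists_forall_mem_iff hA' hA hsep' fun s hs => (hinter s hs).symm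
  exact ⟨{ toFun := φ
           invFun := ψ
           left_inv := fun x => hsep.eq_of_mem_iff fun i => ((hφ x i).trans (hψ _ i)).symm
           right_inv := fun y => hsep'.eq_of_mem_iff fun i => ((hψ y i).trans (hφ _ i)).symm
           continuous_toFun := hsep'.continuous_of_mem_iff hA hφ
           continuous_invFun := hsep.continuous_of_mem_iff hA' hψ }⟩

end IndexedHomeomorph

/-! ### The remainder of an ordered space -/

section OrderedSpace

variable {X : Type*} [LinearOrder X] [OrderBot X] [TopologicalSpace X] [OrderTopology X]

/-- A closed unbounded set leaves a trace on the remainder: otherwise its image would be closed in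
`βX`, hence compact, and the set would be bounded. -/
theorem remainderTrace_nonempty [NoMaxOrder X] {Z : Set X} (hZ : IsClosed Z)
    (h : ∀ a, ∃ z ∈ Z, a ≤ z) : (remainderTrace Z).Nonempty := by
  by_contra hne
  have hsub : closure (stoneCechUnit '' Z) ⊆ range (stoneCechUnit : X → StoneCech X) :=
    fun p hp => by_contra fun hp' => hne ⟨⟨p, hp'⟩, hp⟩
  have hemb : IsEmbedding (stoneCechUnit : X → StoneCech X) := isEmbedding_stoneCechUnit
  have heq : closure (stoneCechUnit '' Z) = (stoneCechUnit '' Z : Set (StoneCech X)) := by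
    refine Subset.antisymm (fun p hp => ?_) subset_closure
    obtain ⟨x, rfl⟩ := hsub hp
    rw [← hZ.closure_eq, hemb.closure_eq_preimage_closure_image]
    exact mem_image_of_mem _ hp
  have hcomp : IsCompact Z := hemb.isCompact_iff.2 (heq ▸ isClosed_closure.isCompact)
  obtain ⟨b, hb⟩ := hcomp.bddAbove
  obtain ⟨a, ha⟩ := exists_gt b
  obtain ⟨z, hz, haz⟩ := h a
  exact (ha.trans_le haz).not_ge (hb hz)

variable [PreconnectedSpace X]

theorem closure_image_stoneCechUnit_Iic_subset_range (a : X) :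
    closure (stoneCechUnit '' Iic a) ⊆ range (stoneCechUnit : X → StoneCech X) := by
  have h : IsCompact (stoneCechUnit '' Iic a : Set (StoneCech X)) := by
    rw [← Icc_bot]
    exact (isCompact_Icc_of_connectedSpace ⊥ a).image continuous_stoneCechUnit
  rw [h.isClosed.closure_eq]
  exact image_subset_range _ _

/-- The space is open in its Čech–Stone compactification. -/
theorem isOpen_range_stoneCechUnit [NoMaxOrder X] :
    IsOpen (range (stoneCechUnit : X → StoneCech X)) := by
  rw [isOpen_iff_mem_nhds]
  rintro _ ⟨x, rfl⟩
  obtain ⟨b, hb⟩ := exists_gt x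
  -- The closures of `[⊥, b]` and `[b, →)` cover `βX`, and the latter misses `x`.
  have hdisj := disjoint_closure_image_stoneCechUnit (isClosed_singleton (x := x))
    (isClosed_Ici (a := b)) (by simpa using hb)
  have hx : stoneCechUnit x ∉ closure (stoneCechUnit '' Ici b) :=
    disjoint_left.1 hdisj (subset_closure (mem_image_of_mem _ rfl))
  filter_upwards [isClosed_closure.isOpen_compl.mem_nhds hx] with p hp
  have hp' : p ∈ closure (stoneCechUnit '' Iic b ∪ stoneCechUnit '' Ici b) := by
    rw [← image_union, Iic_union_Ici, image_univ]
    exact denseRange_stoneCechUnit p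
  rw [closure_union] at hp'
  exact closure_image_stoneCechUnit_Iic_subset_range b (hp'.resolve_right hp)

/-- A set that leaves a trace on the remainder is unbounded, since initial segments are compact. -/
theorem exists_mem_ge_of_mem_remainderTrace {Z : Set X} {p : StoneCechRemainder X}
    (hp : p ∈ remainderTrace Z) (a : X) : ∃ z ∈ Z, a ≤ z := by
  by_contra! h
  exact p.2 (closure_image_stoneCechUnit_Iic_subset_range a
    (closure_mono (image_mono fun z hz => (h z hz).le) hp))

end OrderedSpace

/-! ### Closed sets given by codes and their traces on the remainder -/

namespace OrderFrame

variable {X : Type*} [LinearOrder X] [OrderBot X] [TopologicalSpace X] [OrderTopology X]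
  (F : OrderFrame X)

theorem isClosed_cover (c : F.Code) (n : ℕ) : IsClosed (F.cover c n) :=
  (c n).finite_toSet.isClosed_biUnion fun _ _ => isClosed_Icc

theorem isClosed_realize (c : F.Code) : IsClosed (F.realize c) := by
  refine LocallyFinite.isClosed_iUnion (fun x => ?_)
    fun n => isClosed_Icc.inter (F.isClosed_cover c n)
  obtain ⟨N, hN⟩ := F.cofinal x
  refine ⟨Iio (F.pt N), Iio_mem_nhds hN, (finite_Iio N).subset ?_⟩
  rintro n ⟨y, ⟨hy, -⟩, hyN⟩
  exact F.strictMono.lt_iff_lt.1 (lt_of_le_of_lt hy.1 hyN)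

/-- Every point has arbitrarily small neighbourhoods that are closed intervals with endpoints in
the dense set of the frame. -/
theorem exists_Icc_mem_nhds [NoMaxOrder X] {x : X} {U : Set X} (hU : U ∈ 𝓝 x) :
    ∃ p : F.D × F.D, Icc (p.1 : X) p.2 ∈ 𝓝 x ∧ Icc (p.1 : X) p.2 ⊆ U := by
  obtain ⟨u, hxu, hu⟩ := exists_Ico_subset_of_mem_nhds hU (exists_gt x)
  obtain ⟨b, hb, hxb, hbu⟩ := F.exists_mem_Ioo x u hxu
  rcases eq_or_ne x ⊥ with rfl | hx
  · refine ⟨(⟨⊥, F.bot_mem⟩, ⟨b, hb⟩), ?_, fun z hz => hu ⟨hz.1, hz.2.trans_lt hbu⟩⟩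
    filter_upwards [Iio_mem_nhds hxb] with z hz using ⟨bot_le, le_of_lt hz⟩
  · obtain ⟨l, hlx, hl⟩ := exists_Ioc_subset_of_mem_nhds hU ⟨⊥, bot_lt_iff_ne_bot.2 hx⟩
    obtain ⟨a, ha, hla, hax⟩ := F.exists_mem_Ioo l x hlx
    refine ⟨(⟨a, ha⟩, ⟨b, hb⟩), Icc_mem_nhds hax hxb, fun z hz => ?_⟩
    rcases le_total z x with hzx | hzx
    · exact hl ⟨hla.trans_le hz.1, hzx⟩
    · exact hu ⟨hzx, hz.2.trans_lt hbu⟩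

variable [PreconnectedSpace X]

/-- Given two open sets covering the space, there are two codes whose sets refine this cover and
together contain everything from the first cutting point on. -/
theorem exists_codes_of_open_cover [NoMaxOrder X] {U V : Set X} (hU : IsOpen U) (hV : IsOpen V)
    (hUV : U ∪ V = Set.univ) :
    ∃ c d : F.Code, F.realize c ⊆ U ∧ F.realize d ⊆ V ∧
      Ici (F.pt 0) ⊆ F.realize c ∪ F.realize d := by
  classical
  have hstage : ∀ n, ∃ c d : Finset (F.D × F.D), (∀ p ∈ c, Icc (p.1 : X) p.2 ⊆ U) ∧
      (∀ p ∈ d, Icc (p.1 : X) p.2 ⊆ V) ∧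
      ∀ x ∈ Icc (F.pt n) (F.pt (n + 1)), ∃ p ∈ c ∪ d, x ∈ Icc (p.1 : X) p.2 := by
    intro n
    have hloc : ∀ x : X, ∃ p : F.D × F.D, Icc (p.1 : X) p.2 ∈ 𝓝 x ∧
        (Icc (p.1 : X) p.2 ⊆ U ∨ Icc (p.1 : X) p.2 ⊆ V) := by
      intro x
      have hx : x ∈ U ∪ V := hUV ▸ mem_univ x
      rcases hx with hx | hx
      · obtain ⟨p, hp, hpU⟩ := F.exists_Icc_mem_nhds (hU.mem_nhds hx)
        exact ⟨p, hp, Or.inl hpU⟩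
      · obtain ⟨p, hp, hpV⟩ := F.exists_Icc_mem_nhds (hV.mem_nhds hx)
        exact ⟨p, hp, Or.inr hpV⟩
    choose p hp hpUV using hloc
    obtain ⟨t, -, ht⟩ := (isCompact_Icc_of_connectedSpace (F.pt n) (F.pt (n + 1))).elim_nhds_subcover
      (fun x => Icc ((p x).1 : X) (p x).2) fun x _ => hp x
    refine ⟨(t.image p).filter fun q => Icc (q.1 : X) q.2 ⊆ U,
      (t.image p).filter fun q => Icc (q.1 : X) q.2 ⊆ V,
      fun q hq => (Finset.mem_filter.1 hq).2, fun q hq => (Finset.mem_filter.1 hq).2,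
      fun x hx => ?_⟩
    obtain ⟨z, hz, hxz⟩ := mem_iUnion₂.1 (ht hx)
    refine ⟨p z, ?_, hxz⟩
    rw [← Finset.filter_or, Finset.mem_filter]
    exact ⟨Finset.mem_image_of_mem p hz, hpUV z⟩
  choose c d hc hd hcd using hstage
  refine ⟨c, d, ?_, ?_, fun x hx => ?_⟩
  · refine iUnion_subset fun n x hx => ?_
    obtain ⟨p, hp, hxp⟩ := F.mem_cover.1 hx.2
    exact hc n p hp hxp
  · refine iUnion_subset fun n x hx => ?_
    obtain ⟨p, hp, hxp⟩ := F.mem_cover.1 hx.2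
    exact hd n p hp hxp
  · obtain ⟨n, -, hn⟩ := F.exists_mem_Ico hx
    obtain ⟨p, hp, hxp⟩ := hcd n x ⟨hn.1, hn.2.le⟩
    rcases Finset.mem_union.1 hp with hp | hp
    · exact Or.inl (mem_iUnion.2 ⟨n, ⟨hn.1, hn.2.le⟩, F.mem_cover.2 ⟨p, hp, hxp⟩⟩)
    · exact Or.inr (mem_iUnion.2 ⟨n, ⟨hn.1, hn.2.le⟩, F.mem_cover.2 ⟨p, hp, hxp⟩⟩)

/-- Disjoint closed sets in the remainder are separated by a continuous function on `βX`, and the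
sets where it is `> 1/3` and `< 2/3` are refined by codes. -/
theorem separatesClosed_remainderTrace [NoMaxOrder X] :
    SeparatesClosed fun c : F.Code => remainderTrace (F.realize c) := by
  intro P Q hP hQ hPQ
  have hemb : IsClosedEmbedding (Subtype.val : StoneCechRemainder X → StoneCech X) :=
    isOpen_range_stoneCechUnit.isClosed_compl.isClosedEmbedding_subtypeVal
  obtain ⟨f, hf0, hf1, -⟩ := exists_continuous_zero_one_of_isClosed
    (hemb.isClosedMap _ hP) (hemb.isClosedMap _ hQ)
    ((disjoint_image_iff Subtype.val_injective).2 hPQ)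
  have hfu : Continuous fun x : X => f (stoneCechUnit x) :=
    f.continuous.comp continuous_stoneCechUnit
  obtain ⟨c, d, hc, hd, hcd⟩ := F.exists_codes_of_open_cover
    (isOpen_lt continuous_const hfu : IsOpen {x : X | 1 / 3 < f (stoneCechUnit x)})
    (isOpen_lt hfu continuous_const : IsOpen {x : X | f (stoneCechUnit x) < 2 / 3}) (by
      ext x
      refine iff_of_true ?_ (mem_univ x)
      exact (lt_or_ge (1 / 3) (f (stoneCechUnit x))).imp id fun h => lt_of_le_of_lt h (by norm_num))
  refine ⟨c, d, ?_, ?_, ?_⟩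
  · refine eq_univ_of_forall fun p => ?_
    have hp : p.1 ∈ closure (stoneCechUnit '' Iic (F.pt 0) ∪
        (stoneCechUnit '' F.realize c ∪ stoneCechUnit '' F.realize d)) := by
      rw [← image_union, ← image_union, eq_univ_of_forall (s := Iic (F.pt 0) ∪ _), image_univ]
      · exact denseRange_stoneCechUnit p.1
      · exact fun x => (le_total x (F.pt 0)).imp id fun h => hcd h
    rw [closure_union, closure_union] at hp
    exact hp.resolve_left fun h => p.2 (closure_image_stoneCechUnit_Iic_subset_range _ h)
  · refine disjoint_left.2 fun p hp hpP => ?_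
    have h1 : closure (stoneCechUnit '' F.realize c) ⊆ {q | 1 / 3 ≤ f q} := by
      refine closure_minimal ?_ (isClosed_le continuous_const f.continuous)
      rintro _ ⟨x, hx, rfl⟩
      exact le_of_lt (show 1 / 3 < f (stoneCechUnit x) from hc hx)
    have h2 : (1 / 3 : ℝ) ≤ f p.1 := h1 hp
    have h3 : f p.1 = 0 := hf0 (mem_image_of_mem _ hpP)
    linarith
  · refine disjoint_left.2 fun p hp hpQ => ?_
    have h1 : closure (stoneCechUnit '' F.realize d) ⊆ {q | f q ≤ 2 / 3} := by
      refine closure_minimal ?_ (isClosed_le f.continuous continuous_const)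
      rintro _ ⟨x, hx, rfl⟩
      exact le_of_lt (show f (stoneCechUnit x) < 2 / 3 from hd hx)
    have h2 : f p.1 ≤ 2 / 3 := h1 hp
    have h3 : f p.1 = 1 := hf1 (mem_image_of_mem _ hpQ)
    linarith

variable {Y : Type*} [LinearOrder Y] [OrderBot Y] [TopologicalSpace Y] [OrderTopology Y]
  [NoMaxOrder Y] {F} {G : OrderFrame Y}

/-- The traces of finitely many first codes meet only if the traces of the second codes do:
both amount to unboundedness of the intersection of the sets themselves, and unboundedness is
transported by counterparts. -/
theorem Coherent.biInter_remainderTrace_nonempty {S : Set (F.Code × G.Code)}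
    (h : Coherent F G S) {T : Set (F.Code × G.Code)} (hT : T ⊆ S) (hfin : T.Finite)
    (hne : (⋂ t ∈ T, remainderTrace (F.realize t.1)).Nonempty) :
    (⋂ t ∈ T, remainderTrace (G.realize t.2)).Nonempty := by
  obtain ⟨p, hp⟩ := hne
  have hp' : p ∈ remainderTrace (⋂ t ∈ T, F.realize t.1) :=
    mem_closure_image_stoneCechUnit_biInter hfin (fun t => F.isClosed_realize t.1)
      fun t ht => mem_iInter₂.1 hp t ht
  obtain ⟨N, hN⟩ := h.exists_counterpart hT hfin
  obtain ⟨q, hq⟩ := remainderTrace_nonempty (Z := ⋂ t ∈ T, G.realize t.2)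
    (isClosed_biInter fun t _ => G.isClosed_realize t.2) (by
      intro b
      obtain ⟨M, hM⟩ := G.cofinal b
      obtain ⟨x, hxT, hx⟩ := exists_mem_ge_of_mem_remainderTrace hp' (F.pt (max M N))
      obtain ⟨n, hn, hxn⟩ := F.exists_mem_Ico hx
      obtain ⟨y, hy, hyT⟩ := hN n ((le_max_right _ _).trans hn) x hxn
      refine ⟨y, mem_iInter₂.2 fun t ht => (hyT t ht).1 (mem_iInter₂.1 hxT t ht), ?_⟩
      exact hM.le.trans ((G.strictMono.monotone ((le_max_left _ _).trans hn)).trans hy.1))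
  refine ⟨q, mem_iInter₂.2 fun t ht => ?_⟩
  exact closure_mono (image_mono (biInter_subset_of_mem ht)) hq

variable [NoMaxOrder X] [PreconnectedSpace Y]

theorem nonempty_remainder_homeomorph {S : Set (F.Code × G.Code)} (h : Coherent F G S)
    (h1 : ∀ c, ∃ d, (c, d) ∈ S) (h2 : ∀ d, ∃ c, (c, d) ∈ S) :
    Nonempty (StoneCechRemainder X ≃ₜ StoneCechRemainder Y) := by
  have : CompactSpace (StoneCechRemainder X) :=
    isCompact_iff_compactSpace.1 isOpen_range_stoneCechUnit.isClosed_compl.isCompact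
  have : CompactSpace (StoneCechRemainder Y) :=
    isCompact_iff_compactSpace.1 isOpen_range_stoneCechUnit.isClosed_compl.isCompact
  refine nonempty_homeomorph_of_finite_inter
    (A := fun s : S => remainderTrace (F.realize s.1.1))
    (A' := fun s : S => remainderTrace (G.realize s.1.2))
    (fun s => isClosed_remainderTrace _) (fun s => isClosed_remainderTrace _) ?_ ?_ ?_
  · intro P Q hP hQ hPQ
    obtain ⟨c, d, hcd⟩ := F.separatesClosed_remainderTrace P Q hP hQ hPQ
    obtain ⟨c', hc'⟩ := h1 c
    obtain ⟨d', hd'⟩ := h1 d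
    exact ⟨⟨_, hc'⟩, ⟨_, hd'⟩, hcd⟩
  · intro P Q hP hQ hPQ
    obtain ⟨c, d, hcd⟩ := G.separatesClosed_remainderTrace P Q hP hQ hPQ
    obtain ⟨c', hc'⟩ := h2 c
    obtain ⟨d', hd'⟩ := h2 d
    exact ⟨⟨_, hc'⟩, ⟨_, hd'⟩, hcd⟩
  · intro s hs
    have hsS : Subtype.val '' s ⊆ S := by
      rintro _ ⟨t, -, rfl⟩
      exact t.2
    constructor
    · intro hne
      have := h.biInter_remainderTrace_nonempty hsS (hs.image _) (by rwa [biInter_image])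
      rwa [biInter_image] at this
    · intro hne
      have := h.swap.biInter_remainderTrace_nonempty (image_mono hsS) ((hs.image _).image _)
        (by rwa [biInter_image, biInter_image])
      rwa [biInter_image, biInter_image] at this

end OrderFrame

/-! ### Existence of frames and the cardinality of codes -/

/-- A dense linear order whose cofinality is countable and whose topology has weight at most `𝔠` carries
a frame with at most `𝔠` admissible endpoints. -/
theorem OrderFrame.exists_mk_le_continuum {X : Type*} [LinearOrder X] [TopologicalSpace X]
    [OrderTopology X] [DenselyOrdered X] [OrderBot X] [NoMaxOrder X] (hcof : Order.cof X = ℵ₀)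
    (hweight : topWeight X ≤ 𝔠) : ∃ F : OrderFrame X, #F.D ≤ 𝔠 := by
  obtain ⟨B, hB, hBX⟩ := exists_isTopologicalBasis_mk_eq_topWeight X
  obtain ⟨C, hC, hCX⟩ := Order.exists_cof_eq X
  have hCc : C.Countable := by
    rw [← le_aleph0_iff_set_countable, hCX, hcof]
  obtain ⟨s, hs⟩ := hCc.exists_eq_range hC.nonempty
  obtain ⟨x₀, hx₀⟩ := exists_gt (⊥ : X)
  choose up hup using fun a : X => exists_gt a
  let x : ℕ → X := fun n => Nat.rec x₀ (fun n y => up (max y (s n))) n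
  have hx : ∀ n, max (x n) (s n) < x (n + 1) := fun n => hup _
  -- One point from every basic open set gives a dense set.
  let pick : B → X := fun U => Classical.epsilon fun z => z ∈ U.1
  refine ⟨⟨range pick ∪ insert ⊥ (range x), x, Or.inr (mem_insert _ _),
    fun n => Or.inr (mem_insert_of_mem _ (mem_range_self n)), fun a b hab => ?_,
    strictMono_nat_of_lt_succ fun n => (le_max_left _ _).trans_lt (hx n), hx₀, fun a => ?_⟩, ?_⟩
  · obtain ⟨z, hz⟩ := exists_between hab
    obtain ⟨U, hU, hzU, hUs⟩ := hB.exists_subset_of_mem_open (show z ∈ Ioo a b from hz) isOpen_Ioo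
    have h : pick ⟨U, hU⟩ ∈ U := Classical.epsilon_spec (p := fun z => z ∈ U) ⟨z, hzU⟩
    exact ⟨pick ⟨U, hU⟩, Or.inl (mem_range_self _), hUs h⟩
  · obtain ⟨c, hc, hac⟩ := hC a
    rw [hs] at hc
    obtain ⟨n, rfl⟩ := hc
    exact ⟨n + 1, hac.trans_lt ((le_max_right _ _).trans_lt (hx n))⟩
  · refine (mk_union_le _ _).trans (add_le_of_le aleph0_le_continuum ?_ ?_)
    · exact mk_range_le.trans (hBX.trans_le hweight)
    · exact ((countable_range x).insert ⊥).le_aleph0.trans aleph0_le_continuum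

/-- The half line has a frame with at most `𝔠` admissible endpoints. -/
theorem OrderFrame.exists_Ici_mk_le_continuum :
    ∃ F : OrderFrame (Ici (0 : ℝ)), #F.D ≤ 𝔠 := by
  refine ⟨⟨Set.univ, fun n => ⟨n + 1, by simp only [mem_Ici]; positivity⟩, mem_univ _,
    fun n => mem_univ _, fun a b hab => ?_, ?_, ?_, fun a => ?_⟩, ?_⟩
  · obtain ⟨z, hz⟩ := exists_between hab
    exact ⟨z, mem_univ z, hz⟩
  · refine strictMono_nat_of_lt_succ fun n => Subtype.mk_lt_mk.2 ?_
    push_cast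
    linarith
  · refine Subtype.mk_lt_mk.2 ?_
    push_cast
    norm_num
  · obtain ⟨n, hn⟩ := exists_nat_gt a.1
    exact ⟨n, Subtype.mk_lt_mk.2 (hn.trans (lt_add_one _))⟩
  · exact (mk_set_le _).trans ((mk_set_le _).trans mk_real.le)

theorem OrderFrame.mk_code_le_continuum {X : Type*} [LinearOrder X] [OrderBot X]
    (F : OrderFrame X) (hF : #F.D ≤ 𝔠) : #F.Code ≤ 𝔠 := by
  have h1 : #(F.D × F.D) ≤ 𝔠 := by
    rw [mk_prod, lift_id]
    exact (mul_le_mul' hF hF).trans continuum_mul_self.le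
  have h2 : #(Finset (F.D × F.D)) ≤ 𝔠 := by
    classical
    refine (mk_le_of_surjective (f := List.toFinset) List.toFinset_surjective).trans ?_
    exact (mk_list_le_max _).trans (max_le aleph0_le_continuum h1)
  have h3 : #F.Code = #(Finset (F.D × F.D)) ^ ℵ₀ := by simp [OrderFrame.Code]
  rw [h3]
  exact (power_le_power_right h2).trans continuum_power_aleph0.le

/-! ### The homeomorphism -/

theorem mainTheorem1
    (CH : Cardinal.continuum.{0} = Cardinal.aleph.{0} 1)
    {X : Type*} [LinearOrder X] [TopologicalSpace X] [OrderTopology X] [ConnectedSpace X]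
    [OrderBot X] [NoMaxOrder X]
    (hcof : Order.cof X = Cardinal.aleph0)
    (hweight : topWeight X ≤ Cardinal.continuum) :
    Nonempty (StoneCechRemainder X ≃ₜ StoneCechRemainder (Set.Ici (0 : ℝ))) := by
  have : DenselyOrdered X := denselyOrdered_of_preconnectedSpace
  have : PreconnectedSpace (Ici (0 : ℝ)) := Subtype.preconnectedSpace isPreconnected_Ici
  have : NoMaxOrder (Ici (0 : ℝ)) :=
    ⟨fun a => ⟨⟨a.1 + 1, add_nonneg (mem_Ici.1 a.2) zero_le_one⟩, Subtype.mk_lt_mk.2 (lt_add_one a.1)⟩⟩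
  obtain ⟨F, hF⟩ := OrderFrame.exists_mk_le_continuum hcof hweight
  obtain ⟨G, hG⟩ := OrderFrame.exists_Ici_mk_le_continuum
  -- Under CH the codes can be enumerated by the first uncountable ordinal.
  let I := (aleph.{0} 1).ord.ToType
  have hI : ∀ i : I, (Iio i).Countable := fun i => by
    rw [← le_aleph0_iff_set_countable, ← Order.lt_succ_iff, succ_aleph0]
    exact (mk_Iio_lt i (by simp [I])).trans_eq (by simp [I])
  have hcard : lift.{0} #(F.Code ⊕ G.Code) ≤ lift #I := by
    have hI' : #I = 𝔠 := by simp [I, CH]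
    rw [hI', mk_sum, lift_continuum, lift_uzero]
    refine add_le_of_le aleph0_le_continuum ?_ ?_
    · exact lift_le_continuum.2 (F.mk_code_le_continuum hF)
    · exact lift_le_continuum.2 (G.mk_code_le_continuum hG)
  obtain ⟨j⟩ := lift_mk_le'.1 hcard
  have : Nonempty (F.Code ⊕ G.Code) := ⟨Sum.inl fun _ => ∅⟩
  obtain ⟨S, hS, h1, h2⟩ := OrderFrame.exists_coherent_total (F := F) (G := G) hI
    (Function.invFun j) (Function.invFun_surjective j.injective)
  exact OrderFrame.nonempty_remainder_homeomorph hS h1 h2
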